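/- Let $G$ be a finite abelian group with identity $e$. A subset $D\subseteq G$ is a $(v,k,\lambda,\mu)$ partial difference set in $G$ if $|G|=v$, $|D|=k$, and each nonidentity element $g\in G$ can be written as $g=\phi\psi^{-1}$ with $(\phi,\psi)\in D\times D$ in exactly $\lambda$ ways if $g\in D$ and in exactly $\mu$ ways if $g\notin D$. It is called regular if moreover $\phi^{-1}\in D$ for every $\phi\in D$, and $e\notin D$. No abelian group of order $100$ contains a $(100,33,8,12)$ regular partial difference set, and no abelian group of order $100$ contains a $(100,36,14,12)$ regular partial difference set. -/

import Mathlib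

/-- `D` is a `(v, k, l, m)` partial difference set in the finite abelian group `G`: the group has
order `v`, `D` is a `k`-subset of `G`, and among the expressions `φ * ψ⁻¹` with `φ, ψ ∈ D` each
nonidentity element of `D` occurs exactly `l` times and each nonidentity element of `G` outside `D`
occurs exactly `m` times. -/
structure IsPartialDifferenceSet {G : Type*} [CommGroup G] [Finite G] [DecidableEq G]
    (D : Finset G) (v k l m : ℕ) : Prop where
  card_group : Nat.card G = v
  card_set : D.card = k
  count_mem : ∀ g ∈ D, g ≠ 1 → ((D ×ˢ D).filter fun p => p.1 * p.2⁻¹ = g).card = l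
  count_notMem : ∀ g ∉ D, g ≠ 1 → ((D ×ˢ D).filter fun p => p.1 * p.2⁻¹ = g).card = m

/-- A partial difference set is regular if it is closed under inversion and does not contain the
identity. -/
structure IsRegularPartialDifferenceSet {G : Type*} [CommGroup G] [Finite G] [DecidableEq G]
    (D : Finset G) (v k l m : ℕ) : Prop extends IsPartialDifferenceSet D v k l m where
  inv_mem : ∀ g ∈ D, g⁻¹ ∈ D
  one_notMem : (1 : G) ∉ D

/-! The quadratic equation for a nontrivial character value has integer roots `c` and `c - 10`, with
`c = 3` or `c = 6`. Let `χ ^ 4 = 1`. Summing the values at `χ * θ` over the 25 characters `θ` with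
`θ ^ 25 = 1` gives 25 times the sum of `χ` over the part of `D` in the subgroup of order 4. Since
the values are rational, Galois conjugation fixes them, so the `θ ≠ 1` with value `c - 10` fall into
orbits of size 4. This fixes the sum modulo 40, too rigidly for the at most three non-identity
elements available. -/

open Polynomial in
/-- A sum of `n`-th roots of unity in `ℂ` that is an integer is unchanged when every summand is
raised to a power coprime to `n`. -/
theorem sum_pow_eq_of_sum_eq_intCast {ι : Type*} (s : Finset ι) (f : ι → ℂ) {n t : ℕ}
    (hn : n ≠ 0) (ht : t.Coprime n) (hf : ∀ i ∈ s, f i ^ n = 1) (z : ℤ)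
    (h : ∑ i ∈ s, f i = z) : ∑ i ∈ s, f i ^ t = z := by
  have : NeZero n := ⟨hn⟩
  have hζ := Complex.isPrimitiveRoot_exp n hn
  set ζ := Complex.exp (2 * Real.pi * Complex.I / n)
  have hex : ∀ i, ∃ a : ℕ, i ∈ s → ζ ^ a = f i := fun i ↦ by
    by_cases hi : i ∈ s
    · obtain ⟨a, -, ha⟩ := hζ.eq_pow_of_pow_eq_one (hf i hi)
      exact ⟨a, fun _ ↦ ha⟩
    · exact ⟨0, fun h' ↦ absurd h' hi⟩
  choose a ha using hex
  have key : ∀ x : ℂ, aeval x (∑ i ∈ s, X ^ a i - C z : ℤ[X]) = ∑ i ∈ s, x ^ a i - z := by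
    intro x
    simp
  have h0 : aeval ζ (∑ i ∈ s, X ^ a i - C z : ℤ[X]) = 0 := by
    rw [key, Finset.sum_congr rfl ha, h, sub_self]
  have hdvd := minpoly.isIntegrallyClosed_dvd (hζ.isIntegral (Nat.pos_of_ne_zero hn)) h0
  rw [hζ.minpoly_eq_pow_coprime ht] at hdvd
  have h1 := aeval_eq_zero_of_dvd_aeval_eq_zero hdvd (minpoly.aeval ℤ (ζ ^ t))
  rw [key, sub_eq_zero] at h1
  rw [← h1]
  refine Finset.sum_congr rfl fun i hi ↦ ?_
  rw [← ha i hi, ← pow_mul, ← pow_mul, mul_comm]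

/-! ### Elements of exponent 4 and 25 -/

theorem card_ker_powMonoidHom_prime_pow {H : Type*} [CommGroup H] [Finite H] {p a m : ℕ}
    (hp : p.Prime) (hm : p.Coprime m) (hH : Nat.card H = p ^ a * m) :
    Nat.card (powMonoidHom (p ^ a) : H →* H).ker = p ^ a := by
  have : Fact p.Prime := ⟨hp⟩
  set K := (powMonoidHom (p ^ a) : H →* H).ker
  have hK : ∀ x, x ∈ K ↔ x ^ p ^ a = 1 := fun x ↦ by simp [K, MonoidHom.mem_ker]
  have hpK : IsPGroup p K := fun x ↦ ⟨a, by
    ext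
    simpa using (hK x).1 x.2⟩
  apply Nat.dvd_antisymm
  · obtain ⟨n, hn⟩ := hpK.exists_card_eq
    have hd : Nat.card K ∣ p ^ a * m := hH ▸ K.card_subgroup_dvd_card
    rw [hn] at hd ⊢
    exact (Nat.Coprime.pow_left n hm).dvd_of_dvd_mul_right hd
  · obtain ⟨S, hS⟩ := Sylow.exists_subgroup_card_pow_prime p (G := H) (n := a)
      (hH ▸ Dvd.intro m rfl)
    rw [← hS]
    refine Subgroup.card_dvd_of_le fun x hx ↦ (hK x).2 ?_
    have := pow_card_eq_one' (x := (⟨x, hx⟩ : S))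
    rw [hS] at this
    exact congrArg Subtype.val this

theorem eq_one_of_pow_twentyFive_of_pow_four {A : Type*} [Group A] {x : A} (h25 : x ^ 25 = 1)
    (h4 : x ^ 4 = 1) : x = 1 := by
  rw [← h25, pow_succ, show 24 = 4 * 6 by norm_num, pow_mul, h4, one_pow, one_mul]

theorem pow_seven_pow_eighteen_of_pow_twentyFive {A : Type*} [Group A] {x : A}
    (h25 : x ^ 25 = 1) : (x ^ 7) ^ 18 = x := by
  rw [← pow_mul, show 7 * 18 = 25 * 5 + 1 by norm_num, pow_add, pow_mul, h25, one_pow, one_mul,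
    pow_one]

theorem mul_pow_fiftySeven {A : Type*} [CommGroup A] {x y : A} (hx : x ^ 4 = 1)
    (hy : y ^ 25 = 1) : (x * y) ^ 57 = x * y ^ 7 := by
  rw [mul_pow, show x ^ 57 = (x ^ 4) ^ 14 * x by rw [← pow_mul, ← pow_succ], hx,
    show y ^ 57 = (y ^ 25) ^ 2 * y ^ 7 by rw [← pow_mul, ← pow_add], hy, one_pow, one_pow, one_mul,
    one_mul]

/-- The map `x ↦ x ^ 7` acts on the nontrivial elements of exponent `25` with orbits of size `4`. -/
theorem four_dvd_card_of_pow_seven_mem {A : Type*} [CommGroup A] [DecidableEq A] (s : Finset A)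
    (hs : ∀ x ∈ s, x ^ 25 = 1 ∧ x ≠ 1 ∧ x ^ 7 ∈ s) : 4 ∣ s.card := by
  induction s using Finset.strongInduction with
  | H s ih =>
    obtain rfl | ⟨x, hx⟩ := s.eq_empty_or_nonempty
    · simp
    obtain ⟨hx25, hx1, hx7⟩ := hs x hx
    have ho : orderOf x ∣ 25 := orderOf_dvd_of_pow_eq_one hx25
    have ho1 : orderOf x ≠ 1 := by simpa using hx1
    have hpow : ∀ a b : ℕ, x ^ a = x ^ b ↔ a ≡ b [MOD orderOf x] := fun a b ↦ pow_eq_pow_iff_modEq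
    have ho' : orderOf x = 5 ∨ orderOf x = 25 := by
      have : orderOf x ∈ Nat.divisors 25 := by simpa using ho
      rw [show Nat.divisors 25 = {1, 5, 25} by decide] at this
      simpa [ho1] using this
    have hx18 : x ^ 18 ∈ s := by
      have h49 := (hs _ (hs _ hx7).2.2).2.2
      rw [← pow_mul, ← pow_mul, show 7 * 7 * 7 = 25 * 13 + 18 by norm_num, pow_add, pow_mul, hx25,
        one_pow, one_mul] at h49
      exact h49
    have hx24 : x ^ 24 ∈ s := by
      have h49 := (hs _ hx7).2.2
      rw [← pow_mul, show 7 * 7 = 25 + 24 by norm_num, pow_add, hx25, one_mul] at h49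
      exact h49
    -- Modulo 25, the powers of 7 are 1, 7, 24, 18; they stay distinct modulo 5.
    set o : Finset A := {x ^ 1, x ^ 7, x ^ 24, x ^ 18} with hodef
    have hocard : o.card = 4 := by
      rw [hodef, Finset.card_insert_of_notMem, Finset.card_insert_of_notMem,
        Finset.card_insert_of_notMem, Finset.card_singleton]
      all_goals
        simp only [Finset.mem_insert, Finset.mem_singleton, hpow]
        rcases ho' with h | h <;> rw [h] <;> decide
    have hos : o ⊆ s := by
      intro y hy
      simp only [hodef, Finset.mem_insert, Finset.mem_singleton] at hy
      rcases hy with rfl | rfl | rfl | rfl <;> simpa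
    have hcard := Finset.card_sdiff_add_card_eq_card hos
    have hlt : s \ o ⊂ s := by
      refine Finset.ssubset_iff_subset_ne.2 ⟨Finset.sdiff_subset, fun h ↦ ?_⟩
      rw [h, hocard] at hcard
      omega
    have hdvd := ih _ hlt fun y hy ↦ by
      rw [Finset.mem_sdiff] at hy
      obtain ⟨hy25, hy1, hy7⟩ := hs y hy.1
      refine ⟨hy25, hy1, Finset.mem_sdiff.2 ⟨hy7, fun hyo ↦ hy.2 ?_⟩⟩
      rw [← pow_seven_pow_eighteen_of_pow_twentyFive hy25]
      simp only [hodef, Finset.mem_insert, Finset.mem_singleton] at hyo ⊢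
      have hred : ∀ a b : ℕ, a ≡ b [MOD 25] → x ^ a = x ^ b :=
        fun a b hab ↦ (hpow a b).2 (hab.of_dvd ho)
      rcases hyo with h | h | h | h <;> rw [h, ← pow_mul]
      · exact .inr (.inr (.inr (hred _ _ (by decide))))
      · exact .inl (hred _ _ (by decide))
      · exact .inr (.inl (hred _ _ (by decide)))
      · exact .inr (.inr (.inl (hred _ _ (by decide))))
    rw [← hcard, hocard]
    exact dvd_add hdvd dvd_rfl

/-! ### Character values of partial difference sets -/

section CharacterSums

variable {G : Type*} [CommGroup G]

/-- The value of the character `χ` on the group ring element `∑ g ∈ D, g`. -/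
noncomputable def charSum (D : Finset G) (χ : G →* ℂˣ) : ℂ := ∑ g ∈ D, (χ g : ℂ)

theorem sum_character_eq_zero [Fintype G] {χ : G →* ℂˣ} (hχ : χ ≠ 1) : ∑ g, (χ g : ℂ) = 0 := by
  obtain ⟨a, ha⟩ : ∃ a, χ a ≠ 1 := by
    by_contra! h
    exact hχ (MonoidHom.ext h)
  have h : (χ a : ℂ) * ∑ g, (χ g : ℂ) = ∑ g, (χ g : ℂ) := by
    rw [Finset.mul_sum]
    refine Fintype.sum_equiv (Equiv.mulLeft a) _ _ fun g ↦ ?_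
    simp
  have h' : ((χ a : ℂ) - 1) * ∑ g, (χ g : ℂ) = 0 := by rw [sub_mul, h, one_mul, sub_self]
  refine (mul_eq_zero.1 h').resolve_left fun h1 ↦ ha ?_
  exact Units.ext (sub_eq_zero.1 h1)

theorem charSum_pow_eq_of_eq_intCast [Finite G] (D : Finset G) (χ : G →* ℂˣ) {t : ℕ}
    (ht : t.Coprime (Nat.card G)) (z : ℤ) (h : charSum D χ = z) : charSum D (χ ^ t) = z := by
  have := sum_pow_eq_of_sum_eq_intCast D (fun g ↦ (χ g : ℂ)) Nat.card_pos.ne' ht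
    (fun g _ ↦ by rw [← Units.val_pow_eq_pow_val, ← map_pow, pow_card_eq_one']; simp) z h
  simpa [charSum] using this

/-- In the group ring, `D * D⁻¹ = (k - m) + (l - m) D + m G`; a nontrivial character kills `G`, and
`D⁻¹ = D`. -/
theorem IsRegularPartialDifferenceSet.charSum_sq [Finite G] [DecidableEq G] {D : Finset G}
    {v k l m : ℕ} (h : IsRegularPartialDifferenceSet D v k l m) {χ : G →* ℂˣ} (hχ : χ ≠ 1) :
    charSum D χ ^ 2 = k + l * charSum D χ - m * (1 + charSum D χ) := by
  have : Fintype G := Fintype.ofFinite G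
  have hinv : charSum D χ = ∑ g ∈ D, (χ g⁻¹ : ℂ) :=
    Finset.sum_bij' (fun g _ ↦ g⁻¹) (fun g _ ↦ g⁻¹) (fun g hg ↦ h.inv_mem g hg)
      (fun g hg ↦ h.inv_mem g hg) (by simp) (by simp) (by simp)
  have hcount : ∀ g : G, (((D ×ˢ D).filter fun p => p.1 * p.2⁻¹ = g).card : ℂ) =
      (k - m) * (if g = 1 then 1 else 0) + (l - m) * (if g ∈ D then 1 else 0) + m := by
    intro g
    by_cases hg : g = 1
    · subst hg
      have : ((D ×ˢ D).filter fun p => p.1 * p.2⁻¹ = 1) = D.image fun x ↦ (x, x) := by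
        ext ⟨x, y⟩
        simp only [Finset.mem_filter, Finset.mem_product, Finset.mem_image, mul_inv_eq_one,
          Prod.mk.injEq]
        grind
      rw [this, Finset.card_image_of_injective _ fun x y hxy ↦ (Prod.mk.inj hxy).1, h.card_set]
      simp [h.one_notMem]
    · by_cases hD : g ∈ D
      · rw [h.count_mem g hD hg]
        simp [hg, hD]
      · rw [h.count_notMem g hD hg]
        simp [hg, hD]
  have hprod : charSum D χ ^ 2 = ∑ p ∈ D ×ˢ D, (χ (p.1 * p.2⁻¹) : ℂ) := by
    rw [sq]
    nth_rw 2 [hinv]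
    rw [charSum, Finset.sum_mul_sum, Finset.sum_product]
    simp
  have hfib : ∑ p ∈ D ×ˢ D, (χ (p.1 * p.2⁻¹) : ℂ) =
      ∑ g : G, (((D ×ˢ D).filter fun p => p.1 * p.2⁻¹ = g).card : ℂ) * (χ g : ℂ) := by
    rw [← Finset.sum_fiberwise (D ×ˢ D) (fun p ↦ p.1 * p.2⁻¹)]
    refine Finset.sum_congr rfl fun g _ ↦ ?_
    rw [← nsmul_eq_mul]
    refine Finset.sum_eq_card_nsmul fun p hp ↦ ?_
    rw [(Finset.mem_filter.1 hp).2]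
  have hD : ∑ g : G, (if g ∈ D then (1 : ℂ) else 0) * (χ g : ℂ) = charSum D χ := by
    simp [charSum]
  rw [hprod, hfib]
  simp_rw [hcount, add_mul, mul_assoc, Finset.sum_add_distrib, ← Finset.mul_sum]
  rw [hD, sum_character_eq_zero hχ]
  simp
  ring

/-- The sum of the characters of exponent dividing `25` over a group of order `100` detects the
elements of exponent dividing `4`. -/
theorem sum_filter_pow_eq_one_apply [Finite G] [DecidableEq G] [Fintype (G →* ℂˣ)]
    [DecidableEq (G →* ℂˣ)] (hG : Nat.card G = 100) (g : G) :
    ∑ θ : G →* ℂˣ with θ ^ 25 = 1, (θ g : ℂ) = if g ^ 4 = 1 then 25 else 0 := by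
  split_ifs with hg
  · have h1 : ∀ θ ∈ (Finset.univ : Finset (G →* ℂˣ)).filter (· ^ 25 = 1), (θ g : ℂ) = 1 := by
      intro θ hθ
      have h25 : θ g ^ 25 = 1 := DFunLike.congr_fun (Finset.mem_filter.1 hθ).2 g
      have h4 : θ g ^ 4 = 1 := by rw [← map_pow, hg, map_one]
      simp [eq_one_of_pow_twentyFive_of_pow_four h25 h4]
    have hcard := card_ker_powMonoidHom_prime_pow (H := G →* ℂˣ) (p := 5) (a := 2) (m := 4)
      (by norm_num) (by norm_num)
      (by rw [CommGroup.card_monoidHom_of_hasEnoughRootsOfUnity, hG]; norm_num)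
    rw [Finset.sum_congr rfl h1, Finset.sum_const, nsmul_eq_mul, mul_one]
    norm_cast
    rw [← Fintype.card_subtype, ← Nat.card_eq_fintype_card]
    refine Eq.trans (Nat.card_congr (Equiv.subtypeEquivRight fun θ ↦ ?_)) hcard
    simp [MonoidHom.mem_ker]
  · obtain ⟨η, hη⟩ := CommGroup.exists_apply_ne_one_of_hasEnoughRootsOfUnity G ℂ hg
    have hη100 : η ^ 100 = 1 := by
      have := pow_card_eq_one' (x := η)
      rwa [CommGroup.card_monoidHom_of_hasEnoughRootsOfUnity, hG] at this
    have hη4 : (η ^ 4) ^ 25 = 1 := by rw [← pow_mul, hη100]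
    set S := ∑ θ : G →* ℂˣ with θ ^ 25 = 1, (θ g : ℂ)
    have h : ((η ^ 4) g : ℂ) * S = S := by
      rw [Finset.mul_sum]
      refine Finset.sum_equiv (Equiv.mulLeft (η ^ 4)) (fun θ ↦ ?_) fun θ _ ↦ ?_
      · simp [mul_pow, hη4]
      · simp
    have h' : (((η ^ 4) g : ℂ) - 1) * S = 0 := by rw [sub_mul, h, one_mul, sub_self]
    refine (mul_eq_zero.1 h').resolve_left fun h1 ↦ hη ?_
    rw [map_pow]
    exact Units.ext (sub_eq_zero.1 h1)

/-- In a group of order `100`, if all nontrivial character values of `D` are `c` or `c - 10`, then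
the characters of exponent dividing `4` satisfy a congruence modulo `40` on the elements of `D` of
exponent dividing `4`. -/
theorem exists_sum_pow_four_eq [Finite G] [DecidableEq G] (hG : Nat.card G = 100) (D : Finset G)
    (c : ℤ) (hD : ∀ χ : G →* ℂˣ, χ ≠ 1 → charSum D χ = c ∨ charSum D χ = (c - 10 : ℤ))
    (χ : G →* ℂˣ) (hχ : χ ^ 4 = 1) :
    ∃ m : ℤ, 25 * ∑ g ∈ D with g ^ 4 = 1, (χ g : ℂ) = charSum D χ + (24 * c - 40 * m : ℤ) := by
  classical
  have : Fintype (G →* ℂˣ) := Fintype.ofFinite _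
  set Θ := (Finset.univ : Finset (G →* ℂˣ)).filter (· ^ 25 = 1) with hΘ
  have hΘmem : ∀ θ, θ ∈ Θ ↔ θ ^ 25 = 1 := fun θ ↦ by simp [hΘ]
  have hne : ∀ θ ∈ Θ.erase 1, χ * θ ≠ 1 := by
    intro θ hθ h
    rw [Finset.mem_erase, hΘmem] at hθ
    refine hθ.1 ?_
    have h4 : χ ^ 4 * θ ^ 4 = 1 := by
      rw [← mul_pow (M := G →* ℂˣ), h, one_pow (M := G →* ℂˣ)]
    rw [hχ, one_mul (M := G →* ℂˣ)] at h4
    exact eq_one_of_pow_twentyFive_of_pow_four hθ.2 h4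
  have hdouble : 25 * ∑ g ∈ D with g ^ 4 = 1, (χ g : ℂ) = ∑ θ ∈ Θ, charSum D (χ * θ) := by
    simp_rw [charSum, MonoidHom.mul_apply, Units.val_mul]
    rw [Finset.sum_comm]
    simp_rw [← Finset.mul_sum, hΘ, sum_filter_pow_eq_one_apply hG]
    rw [Finset.sum_filter, Finset.mul_sum]
    refine Finset.sum_congr rfl fun g _ ↦ ?_
    split_ifs <;> ring
  set N := (Θ.erase 1).filter fun θ ↦ charSum D (χ * θ) = (c - 10 : ℤ) with hN
  have hNdvd : 4 ∣ N.card := by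
    refine four_dvd_card_of_pow_seven_mem N fun θ hθ ↦ ?_
    rw [hN, Finset.mem_filter, Finset.mem_erase, hΘmem] at hθ
    obtain ⟨⟨hθ1, hθ25⟩, hθs⟩ := hθ
    refine ⟨hθ25, hθ1, ?_⟩
    rw [hN, Finset.mem_filter, Finset.mem_erase, hΘmem]
    refine ⟨⟨fun h ↦ hθ1 ?_, ?_⟩, ?_⟩
    · rw [← pow_seven_pow_eighteen_of_pow_twentyFive hθ25, h, one_pow (M := G →* ℂˣ)]
    · rw [← pow_mul, mul_comm, pow_mul, hθ25, one_pow (M := G →* ℂˣ)]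
    · have h57 : (χ * θ) ^ 57 = χ * θ ^ 7 := mul_pow_fiftySeven hχ hθ25
      rw [← h57]
      exact charSum_pow_eq_of_eq_intCast D _ (by rw [hG]; norm_num) _ hθs
  obtain ⟨m, hm⟩ := hNdvd
  refine ⟨m, ?_⟩
  have h1mem : (1 : G →* ℂˣ) ∈ Θ := (hΘmem 1).2 (one_pow (M := G →* ℂˣ) 25)
  have hΘcard : (Θ.erase 1).card = 24 := by
    have := sum_filter_pow_eq_one_apply hG (1 : G)
    rw [← hΘ] at this
    simp only [map_one, Units.val_one, Finset.sum_const, nsmul_eq_mul, mul_one, one_pow,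
      if_true] at this
    rw [Finset.card_erase_of_mem h1mem, show Θ.card = 25 by exact_mod_cast this]
  have hval : ∀ θ ∈ Θ.erase 1, charSum D (χ * θ) =
      c - 10 * if charSum D (χ * θ) = (c - 10 : ℤ) then 1 else 0 := by
    intro θ hθ
    split_ifs with h
    · rw [h]
      push_cast
      ring
    · rw [(hD _ (hne θ hθ)).resolve_right h]
      ring
  rw [hdouble, ← Finset.add_sum_erase _ _ h1mem, mul_one (M := G →* ℂˣ), Finset.sum_congr rfl hval,
    Finset.sum_sub_distrib, ← Finset.mul_sum, Finset.sum_const, hΘcard, Finset.sum_boole, ← hN, hm]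
  push_cast
  simp only [nsmul_eq_mul]
  push_cast
  ring

/-! ### Contradictions modulo 40 -/

theorem card_filter_pow_four_lt [Finite G] [DecidableEq G] (hG : Nat.card G = 100) {D : Finset G}
    (hD : (1 : G) ∉ D) : (D.filter fun g ↦ g ^ 4 = 1).card < 4 := by
  have : Fintype G := Fintype.ofFinite G
  have hcard := card_ker_powMonoidHom_prime_pow (H := G) (p := 2) (a := 2) (m := 25)
    (by norm_num) (by norm_num) (by rw [hG]; norm_num)
  have huniv : ((Finset.univ : Finset G).filter fun g ↦ g ^ 4 = 1).card = 4 := by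
    rw [← Fintype.card_subtype, ← Nat.card_eq_fintype_card]
    refine Eq.trans (Nat.card_congr (Equiv.subtypeEquivRight fun x ↦ ?_)) hcard
    simp [MonoidHom.mem_ker]
  refine lt_of_lt_of_eq ?_ huniv
  refine Finset.card_lt_card (Finset.ssubset_iff_subset_ne.2
    ⟨Finset.filter_subset_filter (· ^ 4 = 1) (Finset.subset_univ D), fun h ↦ hD ?_⟩)
  have : (1 : G) ∈ D.filter (· ^ 4 = 1) := by
    rw [h]
    simp
  exact (Finset.mem_filter.1 this).1

theorem IsRegularPartialDifferenceSet.exists_card_filter_pow_four_eq [Finite G] [DecidableEq G]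
    {D : Finset G} {k l m : ℕ} (h : IsRegularPartialDifferenceSet D 100 k l m) (c : ℤ)
    (hD : ∀ χ : G →* ℂˣ, χ ≠ 1 → charSum D χ = c ∨ charSum D χ = (c - 10 : ℤ)) :
    ∃ n : ℤ, 25 * ((D.filter (· ^ 4 = 1)).card : ℤ) = k + 24 * c - 40 * n := by
  obtain ⟨n, hn⟩ := exists_sum_pow_four_eq h.card_group D c hD 1 (one_pow (M := G →* ℂˣ) 4)
  refine ⟨n, ?_⟩
  simp only [charSum, MonoidHom.one_apply, Units.val_one, Finset.sum_const, nsmul_eq_mul, mul_one,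
    h.card_set] at hn
  rw [add_sub_assoc]
  exact_mod_cast hn

theorem not_isRegularPartialDifferenceSet_100_36_14_12 [Finite G] [DecidableEq G] (D : Finset G) :
    ¬ IsRegularPartialDifferenceSet D 100 36 14 12 := by
  intro h
  obtain ⟨n, hn⟩ := h.exists_card_filter_pow_four_eq 6 fun χ hχ ↦ by
    have h2 := h.charSum_sq hχ
    have h0 : (charSum D χ - 6) * (charSum D χ + 4) = 0 := by
      push_cast at h2
      linear_combination h2
    rcases mul_eq_zero.1 h0 with h1 | h1
    · left
      push_cast
      linear_combination h1
    · right
      push_cast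
      linear_combination h1
  -- Here `hn` reads `25 s = 180 - 40 n`, so `s` is 4 modulo 8, but `s < 4`.
  have := card_filter_pow_four_lt h.card_group h.one_notMem
  omega

theorem not_isRegularPartialDifferenceSet_100_33_8_12 [Finite G] [DecidableEq G] (D : Finset G) :
    ¬ IsRegularPartialDifferenceSet D 100 33 8 12 := by
  intro h
  have hD : ∀ χ : G →* ℂˣ, χ ≠ 1 →
      charSum D χ = (3 : ℤ) ∨ charSum D χ = (3 - 10 : ℤ) := fun χ hχ ↦ by
    have h2 := h.charSum_sq hχ
    have h0 : (charSum D χ - 3) * (charSum D χ + 7) = 0 := by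
      push_cast at h2
      linear_combination h2
    rcases mul_eq_zero.1 h0 with h1 | h1
    · left
      push_cast
      linear_combination h1
    · right
      push_cast
      linear_combination h1
  obtain ⟨n, hn⟩ := h.exists_card_filter_pow_four_eq 3 hD
  have hlt := card_filter_pow_four_lt h.card_group h.one_notMem
  -- `25 s = 105 - 40 n` makes `s` equal to 1 modulo 8. The single element is then its own inverse.
  obtain ⟨p, hp⟩ := Finset.card_eq_one.1 (show (D.filter (· ^ 4 = 1)).card = 1 by omega)
  obtain ⟨hpD, hp4⟩ := Finset.mem_filter.1 (hp ▸ Finset.mem_singleton_self p)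
  have hp1 : p ≠ 1 := fun h1 ↦ h.one_notMem (h1 ▸ hpD)
  have hpinv : p⁻¹ = p := by
    rw [← Finset.mem_singleton, ← hp, Finset.mem_filter]
    exact ⟨h.inv_mem p hpD, by rw [inv_pow, hp4, inv_one]⟩
  obtain ⟨η, hη⟩ := CommGroup.exists_apply_ne_one_of_hasEnoughRootsOfUnity G ℂ hp1
  have hη100 : η ^ 100 = 1 := by
    have := pow_card_eq_one' (x := η)
    rwa [CommGroup.card_monoidHom_of_hasEnoughRootsOfUnity, h.card_group] at this
  have hpη : (η p : ℂ) = -1 := by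
    have hsq : η p * η p = 1 := by
      rw [← map_mul, ← map_one η, ← mul_inv_cancel p, hpinv]
    have hsq' : (η p : ℂ) * η p = 1 := congrArg Units.val hsq
    refine (mul_self_eq_one_iff.1 hsq').resolve_left fun h1 ↦ hη (Units.ext h1)
  -- The odd power 25 keeps the value -1 at `p` and gives a character of exponent 4.
  have hpχ : ((η ^ 25) p : ℂ) = -1 := by
    rw [MonoidHom.pow_apply, Units.val_pow_eq_pow_val, hpη]
    norm_num
  have hχ1 : η ^ 25 ≠ 1 := by
    intro h1
    rw [h1] at hpχ
    norm_num at hpχ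
  obtain ⟨m, hm⟩ := exists_sum_pow_four_eq h.card_group D 3 hD (η ^ 25)
    (by rw [← pow_mul, hη100])
  rw [hp, Finset.sum_singleton, hpχ] at hm
  -- The two values would require `40 m = 100` or `40 m = 90`.
  rcases hD _ hχ1 with h1 | h1
  · rw [h1] at hm
    have : (25 * -1 : ℤ) = 3 + (24 * 3 - 40 * m) := by exact_mod_cast hm
    omega
  · rw [h1] at hm
    have : (25 * -1 : ℤ) = 3 - 10 + (24 * 3 - 40 * m) := by exact_mod_cast hm
    omega

end CharacterSums

theorem mainTheorem6 (G : Type*) [CommGroup G] [Finite G] [DecidableEq G] :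
    (¬ ∃ D : Finset G, IsRegularPartialDifferenceSet D 100 33 8 12) ∧
    (¬ ∃ D : Finset G, IsRegularPartialDifferenceSet D 100 36 14 12) :=
  ⟨fun ⟨D, hD⟩ ↦ not_isRegularPartialDifferenceSet_100_33_8_12 D hD,
    fun ⟨D, hD⟩ ↦ not_isRegularPartialDifferenceSet_100_36_14_12 D hD⟩
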